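/- Let $\mathcal C$ be a category with finite limits in which every object $X$ has a (parametrized) list object $(L(X), r_0^X : \mathbb 1\to L(X), r_1^X : X\times L(X)\to L(X))$: for all $g : A\to B$, $k : X\times B\to B$ there is a unique $f : A\times L(X)\to B$ with $f(a,\varnothing)=g(a)$ and $f(a,x::\ell)=k(x,f(a,\ell))$, where $\varnothing = r_0^X$ and $x::\ell = r_1^X(x,\ell)$. (Equations between terms with variables denote equations between the corresponding arrows, as usual in the internal language.) Let $(N,0,s)$ be a (parametrized) natural numbers object of $\mathcal C$ (one exists, namely $L(\mathbb 1)$): for all $g : A\to B$, $k : A\times N\times B\to B$ there is a unique $f : A\times N\to B$ with $f(a,0)=g(a)$ and $f(a,sn)=k(a,n,f(a,n))$. Define recursively the predecessor $P : N\to N$ ($P0=0$, $P(sn)=n$), truncated subtraction ($m\dot- 0=m$, $m\dot- sn=P(m\dot- n)$), and $\operatorname{len}_X : L(X)\to N$ ($\operatorname{len}\varnothing=0$, $\operatorname{len}(x::\ell)=s(\operatorname{len}\ell)$). Write $m<n$ for $s(m)\dot- n=0$; let $E=\{m:N,\,n:N\mid m<n\}$ be the corresponding equalizer, and $\pi_2^E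 : E\to N$, $(m,n)\mapsto n$. For $l_A : A\to N$, let $E\times_N A$ be the pullback of $\pi_2^E$ and $l_A$; in particular $E\times_N L(X)$ is formed along $\operatorname{len}_X$ and is identified with $\{m:N,\,\ell:L(X)\mid m<\operatorname{len}_X(\ell)\}$. Assume: (H1) for every object $X$, the two commutative squares $$\operatorname{len}_X\circ r_0^X = 0\circ \mathrm{Id}_{\mathbb 1},\qquad \operatorname{len}_X\circ r_1^X = s\circ(\operatorname{len}_X\circ\pi_2)$$ are pullback squares (exhibiting $\mathbb 1$ as the pullback of $\operatorname{len}_X$ and $0$, and $X\times L(X)$ as the pullback of $\operatorname{len}_X$ and $s$); (H2) the coproduct $\mathbb 1\xrightarrow{0}N\xleftarrow{s}N$ is universal, i.e. its pullback along any arrow into $N$ is again a coproduct. Define recursively $\operatorname{tr}_X : L(X)\to L(X)$ ($\operatorname{tr}\varnothing=\varnothing$, $\operatorname{tr}(x::\ell)=\ell$), $\operatorname{tail}_X : N\times L(X)\to L(X)$ ($\operatorname{tail}(0,\ell)=\ell$, $\operatorname{tail}(sn,\ell)=\operatorname{tr}(\operatorname{tail}(n,\ell))$), $\operatorname{zerothDef}_X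 : X\times L(X)\to X$ ($\operatorname{zerothDef}(x,\varnothing)=x$, $\operatorname{zerothDef}(x,y::\ell)=y$), and put $\operatorname{nthDef}_X(x,n,\ell)=\operatorname{zerothDef}_X(x,\operatorname{tail}_X(n,\ell))$. On $E\times_N L(X)$ one has $\operatorname{len}_X(\ell)=s(P(\operatorname{len}_X(\ell)))$, so by (H1) there are unique $\operatorname{def}_X : E\times_N L(X)\to X$ and $\ell' : E\times_N L(X)\to L(X)$ with $\ell=\operatorname{def}_X::\ell'$ and $\operatorname{len}_X(\ell')=P(\operatorname{len}_X(\ell))$. Let $\operatorname{nth}_X : E\times_N L(X)\to X$ be $\operatorname{nth}_X(m,\ell)=\operatorname{nthDef}_X(\operatorname{def}_X,m,\ell)$. **Theorem.** Under (H1) and (H2), for all objects $X$, $A$ and all arrows $l_A : A\to N$ and $g : E\times_N A\to X$, there exists an arrow $h : A\to L(X)$ such that $\operatorname{len}_X\circ h=l_A$ and $\operatorname{nth}_X\circ(\mathrm{Id}_E\times_N h)=g$. -/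

import Mathlib

open CategoryTheory Limits MonoidalCategory CartesianMonoidalCategory

universe v u

namespace ListPoly

variable {C : Type u} [Category.{v} C] [CartesianMonoidalCategory C]

/-! ### Natural numbers objects and list objects -/

variable (C) in
/-- A (parametrized) natural numbers object: for all `g : A ⟶ B` and `h : A × N × B ⟶ B` there is
a unique `f : A × N ⟶ B` with `f(a,0) = g(a)` and `f(a,sn) = h(a,n,f(a,n))`. -/
structure NNO where
  /-- the underlying object -/
  N : C
  /-- zero -/
  zero : 𝟙_ C ⟶ N
  /-- successor -/
  succ : N ⟶ N
  existsUnique_rec : ∀ {A B : C} (g : A ⟶ B) (h : A ⊗ (N ⊗ B) ⟶ B),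
    ∃! f : A ⊗ N ⟶ B,
      lift (𝟙 A) (toUnit A ≫ zero) ≫ f = g ∧
      (A ◁ succ) ≫ f = lift (fst A N) (lift (snd A N) f) ≫ h

/-- A (parametrized) list object on `X`: for all `g : A ⟶ B` and `h : X × B ⟶ B` there is
a unique `f : A × L ⟶ B` with `f(a,∅) = g(a)` and `f(a, x :: ℓ) = h(x,f(a,ℓ))`. -/
structure ListObject (X : C) where
  /-- the underlying object -/
  L : C
  /-- the empty list `r₀` -/
  nil : 𝟙_ C ⟶ L
  /-- the arrow `r₁`, adding a leading element to a list -/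
  cons : X ⊗ L ⟶ L
  existsUnique_rec : ∀ {A B : C} (g : A ⟶ B) (h : X ⊗ B ⟶ B),
    ∃! f : A ⊗ L ⟶ B,
      lift (𝟙 A) (toUnit A ≫ nil) ≫ f = g ∧
      (A ◁ cons) ≫ f = lift (snd A (X ⊗ L) ≫ fst X L) ((A ◁ snd X L) ≫ f) ≫ h

/-! ### Arithmetic in a natural numbers object -/

namespace NNO

variable (𝒩 : NNO C)

/-- The arrow `f : A × N ⟶ B` with `f(a,0) = g(a)` and `f(a,sn) = h(a,n,f(a,n))`. -/
noncomputable def recN {A B : C} (g : A ⟶ B) (h : A ⊗ (𝒩.N ⊗ B) ⟶ B) : A ⊗ 𝒩.N ⟶ B :=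
  (𝒩.existsUnique_rec g h).choose

lemma recN_zero {A B : C} (g : A ⟶ B) (h : A ⊗ (𝒩.N ⊗ B) ⟶ B) :
    lift (𝟙 A) (toUnit A ≫ 𝒩.zero) ≫ 𝒩.recN g h = g :=
  (𝒩.existsUnique_rec g h).choose_spec.1.1

lemma recN_succ {A B : C} (g : A ⟶ B) (h : A ⊗ (𝒩.N ⊗ B) ⟶ B) :
    (A ◁ 𝒩.succ) ≫ 𝒩.recN g h = lift (fst A 𝒩.N) (lift (snd A 𝒩.N) (𝒩.recN g h)) ≫ h :=
  (𝒩.existsUnique_rec g h).choose_spec.1.2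

/-- `recN_zero` at a generalized element. -/
lemma lift_zero_recN {Γ A B : C} (g : A ⟶ B) (h : A ⊗ (𝒩.N ⊗ B) ⟶ B) (a : Γ ⟶ A) :
    lift a (toUnit Γ ≫ 𝒩.zero) ≫ 𝒩.recN g h = a ≫ g := by
  conv_rhs => rw [← 𝒩.recN_zero g h]
  rw [← Category.assoc, comp_lift]
  simp

/-- `recN_succ` at a generalized element. -/
lemma lift_succ_recN {Γ A B : C} (g : A ⟶ B) (h : A ⊗ (𝒩.N ⊗ B) ⟶ B) (a : Γ ⟶ A) (n : Γ ⟶ 𝒩.N) :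
    lift a (n ≫ 𝒩.succ) ≫ 𝒩.recN g h = lift a (lift n (lift a n ≫ 𝒩.recN g h)) ≫ h := by
  have := congrArg (fun k => lift a n ≫ k) (𝒩.recN_succ g h)
  simpa [← Category.assoc, comp_lift] using this

/-- Two arrows out of `A × N` which agree at zero and at successors are equal. -/
lemma cases_ext {A B : C} (f₁ f₂ : A ⊗ 𝒩.N ⟶ B)
    (h0 : lift (𝟙 A) (toUnit A ≫ 𝒩.zero) ≫ f₁ = lift (𝟙 A) (toUnit A ≫ 𝒩.zero) ≫ f₂)
    (hs : (A ◁ 𝒩.succ) ≫ f₁ = (A ◁ 𝒩.succ) ≫ f₂) : f₁ = f₂ := by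
  refine (𝒩.existsUnique_rec (lift (𝟙 A) (toUnit A ≫ 𝒩.zero) ≫ f₁)
    (lift (fst _ _) (snd _ _ ≫ fst _ _) ≫ (A ◁ 𝒩.succ) ≫ f₁)).unique ⟨rfl, ?_⟩ ⟨h0.symm, ?_⟩
  · rw [← Category.assoc, comp_lift]
    simp
  · rw [← hs, ← Category.assoc, comp_lift]
    simp

/-- The predecessor: `P(0) = 0`, `P(sn) = n`. -/
noncomputable def pred : 𝒩.N ⟶ 𝒩.N :=
  lift (toUnit 𝒩.N) (𝟙 𝒩.N) ≫ 𝒩.recN (A := 𝟙_ C) 𝒩.zero (snd _ _ ≫ fst _ _)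

/-- Truncated subtraction `(m,n) ↦ m ∸ n`: `m ∸ 0 = m`, `m ∸ sn = P(m ∸ n)`. -/
noncomputable def sub : 𝒩.N ⊗ 𝒩.N ⟶ 𝒩.N :=
  𝒩.recN (𝟙 𝒩.N) (snd _ _ ≫ snd _ _ ≫ 𝒩.pred)

/-- For generalized elements `m, n` of `N`, the arrow `s(m) ∸ n`. By definition, `m < n` means
that this arrow is equal to zero. -/
noncomputable def ltTerm {Γ : C} (m n : Γ ⟶ 𝒩.N) : Γ ⟶ 𝒩.N :=
  lift (m ≫ 𝒩.succ) n ≫ 𝒩.sub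

lemma comp_ltTerm {Δ Γ : C} (σ : Δ ⟶ Γ) (m n : Γ ⟶ 𝒩.N) :
    σ ≫ 𝒩.ltTerm m n = 𝒩.ltTerm (σ ≫ m) (σ ≫ n) := by
  simp [ltTerm, ← Category.assoc, comp_lift]

/-- Definition by cases: `ite(x,y,0) = x`, `ite(x,y,sn) = y`. -/
noncomputable def ite (B : C) : (B ⊗ B) ⊗ 𝒩.N ⟶ B :=
  𝒩.recN (fst B B) (fst _ _ ≫ snd _ _)

lemma lift_ite_self {Γ B : C} (x : Γ ⟶ B) (n : Γ ⟶ 𝒩.N) :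
    lift (lift x x) n ≫ 𝒩.ite B = x := by
  have key : lift (lift (fst B 𝒩.N) (fst B 𝒩.N)) (snd B 𝒩.N) ≫ 𝒩.ite B = fst B 𝒩.N := by
    apply 𝒩.cases_ext
    · rw [← Category.assoc, comp_lift]
      simp [ite, lift_zero_recN]
    · rw [← Category.assoc, comp_lift]
      simp [ite, lift_succ_recN]
  have := congrArg (fun k => lift x n ≫ k) key
  simpa [← Category.assoc, comp_lift] using this

lemma zero_pred : 𝒩.zero ≫ 𝒩.pred = 𝒩.zero := by
  have h := 𝒩.lift_zero_recN (A := 𝟙_ C) 𝒩.zero (snd _ _ ≫ fst _ _) (𝟙 (𝟙_ C))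
  rw [pred, ← Category.assoc, comp_lift]
  simpa using h

lemma succ_pred : 𝒩.succ ≫ 𝒩.pred = 𝟙 𝒩.N := by
  have h := 𝒩.lift_succ_recN (A := 𝟙_ C) 𝒩.zero (snd _ _ ≫ fst _ _) (toUnit 𝒩.N) (𝟙 𝒩.N)
  rw [pred, ← Category.assoc, comp_lift]
  simpa using h

/-- If `m < n` then `n = s(P(n))`. -/
lemma eq_pred_succ_of_lt {Γ : C} (m n : Γ ⟶ 𝒩.N)
    (h : 𝒩.ltTerm m n = toUnit Γ ≫ 𝒩.zero) : (n ≫ 𝒩.pred) ≫ 𝒩.succ = n := by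
  have key : lift (lift (snd 𝒩.N 𝒩.N ≫ 𝒩.pred ≫ 𝒩.succ) (snd 𝒩.N 𝒩.N))
      (𝒩.ltTerm (fst 𝒩.N 𝒩.N) (snd 𝒩.N 𝒩.N)) ≫ 𝒩.ite 𝒩.N = snd 𝒩.N 𝒩.N := by
    apply 𝒩.cases_ext
    · rw [← Category.assoc, comp_lift, comp_ltTerm]
      have e : 𝒩.ltTerm (𝟙 𝒩.N) (toUnit 𝒩.N ≫ 𝒩.zero) = 𝟙 𝒩.N ≫ 𝒩.succ := by
        simp [ltTerm, sub, lift_zero_recN]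
      simp only [lift_fst, lift_snd, e, ite, lift_succ_recN, comp_lift]
      simp
    · rw [← Category.assoc, comp_lift]
      have e : 𝒩.succ ≫ 𝒩.pred ≫ 𝒩.succ = 𝒩.succ := by
        rw [← Category.assoc, succ_pred, Category.id_comp]
      simp [comp_lift, e, lift_ite_self]
  have := congrArg (fun k => lift m n ≫ k) key
  rw [← Category.assoc, comp_lift, comp_ltTerm] at this
  simpa [comp_lift, h, ite, lift_zero_recN] using this

end NNO

/-! ### Recursion on lists -/

namespace ListObject

variable {X : C} (ℒ : ListObject X)

/-- The recursion property with a more general recursion step: there is a unique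
`f : A × L ⟶ B` with `f(a,∅) = g(a)` and `f(a, x :: ℓ) = h(a,x,ℓ,f(a,ℓ))`. -/
theorem existsUnique_rec' {A B : C} (g : A ⟶ B) (h : A ⊗ (X ⊗ (ℒ.L ⊗ B)) ⟶ B) :
    ∃! f : A ⊗ ℒ.L ⟶ B,
      lift (𝟙 A) (toUnit A ≫ ℒ.nil) ≫ f = g ∧
      (A ◁ ℒ.cons) ≫ f =
        lift (fst A (X ⊗ ℒ.L)) (lift (snd A (X ⊗ ℒ.L) ≫ fst X ℒ.L)
          (lift (snd A (X ⊗ ℒ.L) ≫ snd X ℒ.L) ((A ◁ snd X ℒ.L) ≫ f))) ≫ h := by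
  obtain ⟨F, ⟨hF0, hF1⟩, hFu⟩ := ℒ.existsUnique_rec
    (lift (𝟙 A) (lift (toUnit A ≫ ℒ.nil) g))
    (lift (snd X (A ⊗ (ℒ.L ⊗ B)) ≫ fst _ _)
      (lift (lift (fst _ _) (snd _ _ ≫ snd _ _ ≫ fst _ _) ≫ ℒ.cons)
        (lift (snd _ _ ≫ fst _ _) (lift (fst _ _) (snd _ _ ≫ snd _ _)) ≫ h)))
  have e1 : F ≫ fst _ _ = fst A ℒ.L := by
    refine (ℒ.existsUnique_rec (𝟙 A) (snd X A)).unique ⟨?_, ?_⟩ ⟨by simp, by simp⟩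
    · rw [← Category.assoc, hF0]; simp
    · rw [← Category.assoc, hF1]; simp
  have e2 : F ≫ snd _ _ ≫ fst _ _ = snd A ℒ.L := by
    refine (ℒ.existsUnique_rec (toUnit A ≫ ℒ.nil) ℒ.cons).unique ⟨?_, ?_⟩ ⟨by simp, ?_⟩
    · rw [← Category.assoc, hF0]; simp
    · rw [← Category.assoc, hF1]; simp [← Category.assoc, comp_lift]
    · have : lift (snd A (X ⊗ ℒ.L) ≫ fst X ℒ.L) (A ◁ snd X ℒ.L ≫ snd A ℒ.L) =
          snd A (X ⊗ ℒ.L) := by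
        ext <;> simp
      rw [this]; simp
  refine ⟨F ≫ snd _ _ ≫ snd _ _, ⟨?_, ?_⟩, ?_⟩
  · rw [← Category.assoc, hF0]; simp
  · rw [← Category.assoc, hF1]
    simp only [Category.assoc]
    rw [← Category.assoc, comp_lift, comp_lift]
    simp only [← Category.assoc, lift_snd]
    have e1' : (A ◁ snd X ℒ.L ≫ F) ≫ fst _ _ = fst A (X ⊗ ℒ.L) := by
      rw [Category.assoc, e1]; simp
    have e2' : ((A ◁ snd X ℒ.L ≫ F) ≫ snd _ _) ≫ fst _ _ = snd A (X ⊗ ℒ.L) ≫ snd X ℒ.L := by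
      rw [Category.assoc, Category.assoc, e2]; simp
    congr 1
    ext <;> simp_all
  · rintro f ⟨hf0, hf1⟩
    have : lift (fst A ℒ.L) (lift (snd A ℒ.L) f) = F := by
      apply hFu
      refine ⟨?_, ?_⟩
      · simp [comp_lift, hf0]
      · have ec : snd A (X ⊗ ℒ.L) =
            lift (snd A (X ⊗ ℒ.L) ≫ fst X ℒ.L) (snd A (X ⊗ ℒ.L) ≫ snd X ℒ.L) := by
          ext <;> simp
        ext
        · simp
        · simp only [comp_lift, lift_snd, lift_fst, whiskerLeft_snd, ← Category.assoc]
          conv_lhs => rw [ec]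
        · simp only [comp_lift, lift_snd, lift_fst, whiskerLeft_snd, whiskerLeft_fst,
            ← Category.assoc, hf1]
    rw [← this]; simp

/-- The arrow `f : A × L ⟶ B` with `f(a,∅) = g(a)` and `f(a, x :: ℓ) = h(a,x,ℓ,f(a,ℓ))`. -/
noncomputable def recL {A B : C} (g : A ⟶ B) (h : A ⊗ (X ⊗ (ℒ.L ⊗ B)) ⟶ B) : A ⊗ ℒ.L ⟶ B :=
  (ℒ.existsUnique_rec' g h).choose

/-- `L(𝟙)` is a natural numbers object, with zero `∅` and successor `n ↦ * :: n`. -/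
def toNNO (ℒ : ListObject (𝟙_ C)) : NNO C where
  N := ℒ.L
  zero := ℒ.nil
  succ := lift (toUnit _) (𝟙 _) ≫ ℒ.cons
  existsUnique_rec := by
    intro A B g h
    have hc : lift (toUnit ℒ.L) (𝟙 ℒ.L) ≫ snd (𝟙_ C) ℒ.L = 𝟙 _ := by simp
    have hc' : snd (𝟙_ C) ℒ.L ≫ lift (toUnit ℒ.L) (𝟙 ℒ.L) = 𝟙 _ := by
      apply CartesianMonoidalCategory.hom_ext
      · exact toUnit_unique _ _
      · simp
    have key := ℒ.existsUnique_rec' g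
      (lift (fst A (𝟙_ C ⊗ (ℒ.L ⊗ B))) (snd _ _ ≫ snd _ _) ≫ h)
    refine (existsUnique_congr fun f => and_congr_right fun _ => ?_).mp key
    constructor
    · intro hf
      have := congrArg (fun k => (A ◁ lift (toUnit ℒ.L) (𝟙 ℒ.L)) ≫ k) hf
      simp only [← Category.assoc, ← MonoidalCategory.whiskerLeft_comp, comp_lift, lift_fst,
        lift_snd, whiskerLeft_fst, whiskerLeft_snd, hc] at this
      simpa [Category.assoc] using this
    · intro hf
      have := congrArg (fun k => (A ◁ snd (𝟙_ C) ℒ.L) ≫ k) hf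
      simp only [← Category.assoc, ← MonoidalCategory.whiskerLeft_comp, comp_lift,
        whiskerLeft_fst, whiskerLeft_snd, hc', Category.id_comp] at this
      simpa [← Category.assoc, comp_lift] using this

/-! ### Operations on lists -/

variable (𝒩 : NNO C)

/-- The length: `len(∅) = 0`, `len(x :: ℓ) = s(len(ℓ))`. -/
noncomputable def len : ℒ.L ⟶ 𝒩.N :=
  lift (toUnit ℒ.L) (𝟙 ℒ.L) ≫
    ℒ.recL (A := 𝟙_ C) 𝒩.zero (snd _ _ ≫ snd _ _ ≫ snd _ _ ≫ 𝒩.succ)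

/-- Truncation, removing the leading element: `tr(∅) = ∅`, `tr(x :: ℓ) = ℓ`. -/
noncomputable def tr : ℒ.L ⟶ ℒ.L :=
  lift (toUnit ℒ.L) (𝟙 ℒ.L) ≫
    ℒ.recL (A := 𝟙_ C) ℒ.nil (snd _ _ ≫ snd _ _ ≫ fst _ _)

/-- `tail(n,ℓ)` is `ℓ` with `n` leading elements removed:
`tail(0,ℓ) = ℓ`, `tail(sn,ℓ) = tr(tail(n,ℓ))`. -/
noncomputable def tail : 𝒩.N ⊗ ℒ.L ⟶ ℒ.L :=
  lift (snd _ _) (fst _ _) ≫ 𝒩.recN (𝟙 ℒ.L) (snd _ _ ≫ snd _ _ ≫ ℒ.tr)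

/-- `zerothDef(x,ℓ)` is the leading element of `ℓ`, or `x` if `ℓ` is empty:
`zerothDef(x,∅) = x`, `zerothDef(x, y :: ℓ) = y`. -/
noncomputable def zerothDef : X ⊗ ℒ.L ⟶ X :=
  ℒ.recL (𝟙 X) (snd _ _ ≫ fst _ _)

/-- `nthDef(x,n,ℓ) = zerothDef(x, tail(n,ℓ))`. -/
noncomputable def nthDef : X ⊗ (𝒩.N ⊗ ℒ.L) ⟶ X :=
  (X ◁ ℒ.tail 𝒩) ≫ ℒ.zerothDef

end ListObject

/-! ### The two hypotheses -/

/-- (H1): for every `X`, both squares of the following diagram are pullbacks.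
```
  𝟙 --r₀--> L(X) <--r₁-- X × L(X)
  |          |               |
  |         len          len ∘ π₂
  v          v               v
  𝟙 ---0---> N <-----s------ N
```
-/
def H1 (𝒩 : NNO C) (ℒ : ∀ X : C, ListObject X) : Prop :=
  ∀ X : C,
    IsPullback (ℒ X).nil (𝟙 (𝟙_ C)) ((ℒ X).len 𝒩) 𝒩.zero ∧
    IsPullback (ℒ X).cons (snd X (ℒ X).L ≫ (ℒ X).len 𝒩) ((ℒ X).len 𝒩) 𝒩.succ

/-- (H2): the coproduct `𝟙 --0--> N <--s-- N` is universal, i.e. stable under pullback. -/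
def H2 (𝒩 : NNO C) : Prop :=
  IsUniversalColimit (BinaryCofan.mk 𝒩.zero 𝒩.succ)

/-! ### The object `E`, pullbacks along `E ⟶ N`, and the arrow `nth` -/

section

variable [HasFiniteLimits C] (𝒩 : NNO C)

/-- `E = {m : N, n : N ∣ m < n}`: the equalizer of `(m,n) ↦ s(m) ∸ n` and `(m,n) ↦ 0`. -/
noncomputable def E : C :=
  equalizer (𝒩.ltTerm (fst 𝒩.N 𝒩.N) (snd 𝒩.N 𝒩.N)) (toUnit (𝒩.N ⊗ 𝒩.N) ≫ 𝒩.zero)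

/-- The inclusion of `E` into `N × N`. -/
noncomputable def E.incl : E 𝒩 ⟶ 𝒩.N ⊗ 𝒩.N :=
  equalizer.ι (𝒩.ltTerm (fst 𝒩.N 𝒩.N) (snd 𝒩.N 𝒩.N)) (toUnit (𝒩.N ⊗ 𝒩.N) ≫ 𝒩.zero)

/-- `(m,n) ↦ m` on `E`. -/
noncomputable def E.π₁ : E 𝒩 ⟶ 𝒩.N := E.incl 𝒩 ≫ fst _ _

/-- `(m,n) ↦ n` on `E`. -/
noncomputable def E.π₂ : E 𝒩 ⟶ 𝒩.N := E.incl 𝒩 ≫ snd _ _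

lemma E.lt : 𝒩.ltTerm (E.π₁ 𝒩) (E.π₂ 𝒩) = toUnit (E 𝒩) ≫ 𝒩.zero := by
  have h : E.incl 𝒩 ≫ 𝒩.ltTerm (fst 𝒩.N 𝒩.N) (snd 𝒩.N 𝒩.N) =
      E.incl 𝒩 ≫ toUnit (𝒩.N ⊗ 𝒩.N) ≫ 𝒩.zero := equalizer.condition _ _
  rw [𝒩.comp_ltTerm, ← Category.assoc, comp_toUnit] at h
  exact h

/-- `E ×_N A`, for an arrow `lA : A ⟶ N`. -/
noncomputable abbrev EPull {A : C} (lA : A ⟶ 𝒩.N) : C := pullback (E.π₂ 𝒩) lA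

/-- `Id_E ×_N h : E ×_N A ⟶ E ×_N B`, for an arrow `h : A ⟶ B` over `N`. -/
noncomputable def EPull.map {A B : C} {lA : A ⟶ 𝒩.N} {lB : B ⟶ 𝒩.N} (h : A ⟶ B)
    (w : h ≫ lB = lA) : EPull 𝒩 lA ⟶ EPull 𝒩 lB :=
  pullback.map (E.π₂ 𝒩) lA (E.π₂ 𝒩) lB (𝟙 (E 𝒩)) h (𝟙 𝒩.N) (by simp) (by simp [w])

variable {𝒩} {ℒ : ∀ X : C, ListObject X}

/-- On `E ×_N L(X) = {m : N, ℓ : L(X) ∣ m < len(ℓ)}`, we have `len(ℓ) = s(P(len(ℓ)))`. -/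
lemma EPull.len_eq (X : C) :
    pullback.snd (E.π₂ 𝒩) ((ℒ X).len 𝒩) ≫ (ℒ X).len 𝒩 =
      (pullback.snd (E.π₂ 𝒩) ((ℒ X).len 𝒩) ≫ (ℒ X).len 𝒩 ≫ 𝒩.pred) ≫ 𝒩.succ := by
  have h := 𝒩.eq_pred_succ_of_lt (pullback.fst (E.π₂ 𝒩) ((ℒ X).len 𝒩) ≫ E.π₁ 𝒩)
    (pullback.snd (E.π₂ 𝒩) ((ℒ X).len 𝒩) ≫ (ℒ X).len 𝒩) (by
      rw [← pullback.condition, ← 𝒩.comp_ltTerm, E.lt, ← Category.assoc, comp_toUnit])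
  simpa using h.symm

/-- The default element `def_X : E ×_N L(X) ⟶ X`: since `len(ℓ) = s(P(len(ℓ)))` on `E ×_N L(X)`,
the right-hand pullback square of (H1) provides `x` and `ℓ'` with `ℓ = x :: ℓ'`, and `def_X` is
this `x`. -/
noncomputable def defElt (h1 : H1 𝒩 ℒ) (X : C) : EPull 𝒩 ((ℒ X).len 𝒩) ⟶ X :=
  (h1 X).2.lift (pullback.snd (E.π₂ 𝒩) ((ℒ X).len 𝒩))
    (pullback.snd (E.π₂ 𝒩) ((ℒ X).len 𝒩) ≫ (ℒ X).len 𝒩 ≫ 𝒩.pred) (EPull.len_eq X) ≫ fst _ _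

/-- The arrow `nth_X : E ×_N L(X) ⟶ X`, defined by `nth(m,ℓ) = nthDef(def_X,m,ℓ)` on
`E ×_N L(X) = {m : N, ℓ : L(X) ∣ m < len(ℓ)}`. -/
noncomputable def nth (h1 : H1 𝒩 ℒ) (X : C) : EPull 𝒩 ((ℒ X).len 𝒩) ⟶ X :=
  lift (defElt h1 X)
    (lift (pullback.fst (E.π₂ 𝒩) ((ℒ X).len 𝒩) ≫ E.π₁ 𝒩)
      (pullback.snd (E.π₂ 𝒩) ((ℒ X).len 𝒩))) ≫ (ℒ X).nthDef 𝒩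

end

end ListPoly

/-! Suppose first that there is a default `d : A ⟶ X`. By (H2), `A × N` splits according to whether
`s(m) ∸ lA(a)` is zero or a successor, so `g` on the first part and `d` on the second glue to a
total `G : A × N ⟶ X`. Recursion on `n` produces the list of the last `n` values `[G(a, l ∸ n), …,
G(a, l ∸ 1)]`, where `l = lA(a)`, and `h(a)` is this list at `n = l`. Removing `m` leading elements
lowers `n` to `l ∸ m`; for `m < l` this is a successor, so the leading element is `G(a, l ∸ (l ∸ m))
= G(a,m)`.

In general `X` may have no default. Split `A` by (H2) along `lA`: where `lA(a) = 0` take the empty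
list; where `lA(a)` is a successor, `g(0,a)` is defined and serves as the default.

The arithmetic consists of conditional equations `t = 0 → x = y`. These become plain equations
`ite(x,y,t) = y`, for which induction is available (`hom_ext_induction`,
`hom_ext_double_induction`). An impossible case is one where `0` is a successor; there all parallel
arrows agree. -/

namespace ListPoly

variable {C : Type u} [Category.{v} C] [CartesianMonoidalCategory C]

namespace NNO

/-! ### Case analysis, gluing and induction -/

section Logic

variable [HasFiniteLimits C] {𝒩 : NNO C}

/-- Arrows defined where `t = 0` and where `t` is a successor glue to a unique arrow. -/
lemma nonempty_isColimit_pullback (h2 : H2 𝒩) {Γ : C} (t : Γ ⟶ 𝒩.N) :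
    Nonempty (IsColimit (BinaryCofan.mk (pullback.fst t 𝒩.zero) (pullback.fst t 𝒩.succ))) := by
  refine h2 (BinaryCofan.mk (pullback.fst t 𝒩.zero) (pullback.fst t 𝒩.succ))
    (mapPair (pullback.snd t 𝒩.zero) (pullback.snd t 𝒩.succ)) t ?_ (.of_discrete _) ?_
  · ext ⟨⟨⟩⟩
    · exact pullback.condition.symm
    · exact pullback.condition.symm
  · rintro ⟨⟨⟩⟩
    · exact IsPullback.of_hasPullback t 𝒩.zero
    · exact IsPullback.of_hasPullback t 𝒩.succ

lemma exists_glue (h2 : H2 𝒩) {Γ B : C} (t : Γ ⟶ 𝒩.N) (f₀ : pullback t 𝒩.zero ⟶ B)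
    (f₁ : pullback t 𝒩.succ ⟶ B) :
    ∃ f : Γ ⟶ B, pullback.fst t 𝒩.zero ≫ f = f₀ ∧ pullback.fst t 𝒩.succ ≫ f = f₁ := by
  obtain ⟨hc⟩ := nonempty_isColimit_pullback h2 t
  obtain ⟨f, h⟩ := BinaryCofan.IsColimit.desc' hc f₀ f₁
  exact ⟨f, h⟩

/-- Case analysis on a generalized element `t` of `N`. -/
lemma hom_ext_cases (h2 : H2 𝒩) {Γ B : C} (t : Γ ⟶ 𝒩.N) {f g : Γ ⟶ B}
    (h₀ : ∀ {Δ : C} (σ : Δ ⟶ Γ), σ ≫ t = toUnit Δ ≫ 𝒩.zero → σ ≫ f = σ ≫ g)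
    (h₁ : ∀ {Δ : C} (σ : Δ ⟶ Γ) (i : Δ ⟶ 𝒩.N), σ ≫ t = i ≫ 𝒩.succ → σ ≫ f = σ ≫ g) :
    f = g := by
  obtain ⟨hc⟩ := nonempty_isColimit_pullback h2 t
  have e : pullback.fst t 𝒩.zero ≫ t = toUnit _ ≫ 𝒩.zero := by
    rw [pullback.condition, toUnit_unique (pullback.snd t 𝒩.zero) (toUnit _)]
  exact BinaryCofan.IsColimit.hom_ext hc (h₀ _ e) (h₁ _ _ pullback.condition)

/-- Induction on `N`, for an equation with parameters. -/
lemma hom_ext_induction {A B : C} {f g : A ⊗ 𝒩.N ⟶ B}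
    (h₀ : lift (𝟙 A) (toUnit A ≫ 𝒩.zero) ≫ f = lift (𝟙 A) (toUnit A ≫ 𝒩.zero) ≫ g)
    (h₁ : ∀ {Γ : C} (a : Γ ⟶ A) (n : Γ ⟶ 𝒩.N), lift a n ≫ f = lift a n ≫ g →
      lift a (n ≫ 𝒩.succ) ≫ f = lift a (n ≫ 𝒩.succ) ≫ g) : f = g := by
  let e := equalizer.ι f g
  have he : lift (e ≫ fst _ _) (e ≫ snd _ _) = e := lift_comp_fst_snd e
  have hs := h₁ (e ≫ fst _ _) (e ≫ snd _ _) (by rw [he]; exact equalizer.condition f g)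
  -- Recursion into the equalizer gives a section of `e`: both `r ≫ e` and the identity satisfy the
  -- recursion with start `(a,0)` and step `(a,n) ↦ (a,sn)`. A section of `e` forces `f = g`.
  let r : A ⊗ 𝒩.N ⟶ equalizer f g :=
    𝒩.recN (equalizer.lift _ h₀) (snd _ _ ≫ snd _ _ ≫ equalizer.lift _ hs)
  have hrs : (A ◁ 𝒩.succ) ≫ r = r ≫ equalizer.lift _ hs :=
    (𝒩.recN_succ _ _).trans (by rw [lift_snd_assoc, lift_snd_assoc])
  have hr : r ≫ e = 𝟙 _ := by
    refine (𝒩.existsUnique_rec (lift (𝟙 A) (toUnit A ≫ 𝒩.zero))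
      (snd _ _ ≫ snd _ _ ≫ (A ◁ 𝒩.succ))).unique ⟨?_, ?_⟩ ⟨by simp, by simp⟩
    · rw [← Category.assoc, 𝒩.recN_zero]
      exact equalizer.lift_ι _ _
    · rw [← Category.assoc, hrs, Category.assoc, equalizer.lift_ι]
      simp only [lift_snd_assoc, Category.assoc]
      congr 1
      ext <;> simp [e]
  rw [← Category.id_comp f, ← Category.id_comp g, ← hr, Category.assoc, Category.assoc,
    equalizer.condition]

end Logic

/-! ### Arithmetic at generalized elements of `N` -/

variable {𝒩 : NNO C}

variable (𝒩) in
/-- Zero as a generalized element of `N`. -/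
noncomputable def zr (Γ : C) : Γ ⟶ 𝒩.N := toUnit Γ ≫ 𝒩.zero

/-- The successor of a generalized element of `N`. -/
noncomputable def sc {Γ : C} (n : Γ ⟶ 𝒩.N) : Γ ⟶ 𝒩.N := n ≫ 𝒩.succ

/-- The predecessor of a generalized element of `N`. -/
noncomputable def pr {Γ : C} (n : Γ ⟶ 𝒩.N) : Γ ⟶ 𝒩.N := n ≫ 𝒩.pred

/-- Truncated subtraction of generalized elements of `N`. -/
noncomputable def monus {Γ : C} (m n : Γ ⟶ 𝒩.N) : Γ ⟶ 𝒩.N := lift m n ≫ 𝒩.sub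

lemma ltTerm_eq_monus {Γ : C} (m n : Γ ⟶ 𝒩.N) : 𝒩.ltTerm m n = monus (sc m) n := rfl

@[simp]
lemma comp_zr {Δ Γ : C} (σ : Δ ⟶ Γ) : σ ≫ 𝒩.zr Γ = 𝒩.zr Δ := by
  simp [zr]

@[simp]
lemma comp_sc {Δ Γ : C} (σ : Δ ⟶ Γ) (n : Γ ⟶ 𝒩.N) : σ ≫ sc n = sc (σ ≫ n) := by
  simp [sc]

@[simp]
lemma comp_pr {Δ Γ : C} (σ : Δ ⟶ Γ) (n : Γ ⟶ 𝒩.N) : σ ≫ pr n = pr (σ ≫ n) := by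
  simp [pr]

@[simp]
lemma comp_monus {Δ Γ : C} (σ : Δ ⟶ Γ) (m n : Γ ⟶ 𝒩.N) :
    σ ≫ monus m n = monus (σ ≫ m) (σ ≫ n) := by
  simp [monus, comp_lift_assoc]

@[simp]
lemma pr_zr {Γ : C} : pr (𝒩.zr Γ) = 𝒩.zr Γ := by
  rw [pr, zr, Category.assoc, zero_pred]

@[simp]
lemma pr_sc {Γ : C} (n : Γ ⟶ 𝒩.N) : pr (sc n) = n := by
  rw [pr, sc, Category.assoc, succ_pred, Category.comp_id]

@[simp]
lemma monus_zr {Γ : C} (m : Γ ⟶ 𝒩.N) : monus m (𝒩.zr Γ) = m := by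
  simp [monus, zr, sub, lift_zero_recN]

lemma monus_sc {Γ : C} (m n : Γ ⟶ 𝒩.N) : monus m (sc n) = pr (monus m n) := by
  simp [monus, sc, pr, sub, lift_succ_recN]

lemma lift_zr_recN {Γ A B : C} (g : A ⟶ B) (h : A ⊗ (𝒩.N ⊗ B) ⟶ B) (a : Γ ⟶ A) :
    lift a (𝒩.zr Γ) ≫ 𝒩.recN g h = a ≫ g :=
  𝒩.lift_zero_recN g h a

lemma lift_sc_recN {Γ A B : C} (g : A ⟶ B) (h : A ⊗ (𝒩.N ⊗ B) ⟶ B) (a : Γ ⟶ A)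
    (n : Γ ⟶ 𝒩.N) :
    lift a (sc n) ≫ 𝒩.recN g h = lift a (lift n (lift a n ≫ 𝒩.recN g h)) ≫ h :=
  𝒩.lift_succ_recN g h a n

lemma lift_zr_ite {Γ B : C} (x y : Γ ⟶ B) : lift (lift x y) (𝒩.zr Γ) ≫ 𝒩.ite B = x := by
  simp [ite, lift_zr_recN]

lemma lift_sc_ite {Γ B : C} (x y : Γ ⟶ B) (n : Γ ⟶ 𝒩.N) :
    lift (lift x y) (sc n) ≫ 𝒩.ite B = y := by
  simp [ite, lift_sc_recN]

/-- Where zero is a successor, all parallel arrows are equal. -/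
lemma hom_ext_of_sc_eq_zr {Γ B : C} {n : Γ ⟶ 𝒩.N} (h : sc n = 𝒩.zr Γ) (x y : Γ ⟶ B) :
    x = y := by
  -- `ite(x,y,-)` is `x` at zero and `y` at the successor `sc n`, which here coincide.
  rw [← lift_zr_ite (𝒩 := 𝒩) x y, ← h, lift_sc_ite]

/-! ### Conditional equations, double induction and truncated subtraction -/

section Arithmetic

variable [HasFiniteLimits C]

/-- `ite(x,y,t) = y` expresses the conditional equation `t = 0 → x = y`. -/
lemma ite_eq_of_imp (h2 : H2 𝒩) {Γ B : C} {x y : Γ ⟶ B} {t : Γ ⟶ 𝒩.N}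
    (h : ∀ {Δ : C} (σ : Δ ⟶ Γ), σ ≫ t = 𝒩.zr Δ → σ ≫ x = σ ≫ y) :
    lift (lift x y) t ≫ 𝒩.ite B = y := by
  refine hom_ext_cases h2 t (fun σ hσ => ?_) (fun σ i hσ => ?_)
  · change σ ≫ t = 𝒩.zr _ at hσ
    simp only [comp_lift_assoc, comp_lift, hσ, lift_zr_ite, h σ hσ]
  · change σ ≫ t = sc i at hσ
    simp only [comp_lift_assoc, comp_lift, hσ, lift_sc_ite]

/-- Induction in the form of an equation between generalized elements. -/
lemma comp_eq_of_induction {A B : C} {f g : A ⊗ 𝒩.N ⟶ B}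
    (h₀ : ∀ {Γ : C} (a : Γ ⟶ A), lift a (𝒩.zr Γ) ≫ f = lift a (𝒩.zr Γ) ≫ g)
    (h₁ : ∀ {Γ : C} (a : Γ ⟶ A) (n : Γ ⟶ 𝒩.N), lift a n ≫ f = lift a n ≫ g →
      lift a (sc n) ≫ f = lift a (sc n) ≫ g) {Γ : C} (a : Γ ⟶ A) (n : Γ ⟶ 𝒩.N) :
    lift a n ≫ f = lift a n ≫ g := by
  rw [hom_ext_induction (h₀ (𝟙 A)) h₁]

@[simp]
lemma sc_monus_sc {Γ : C} (m n : Γ ⟶ 𝒩.N) : monus (sc m) (sc n) = monus m n := by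
  have := comp_eq_of_induction (f := monus (sc (fst 𝒩.N 𝒩.N)) (sc (snd 𝒩.N 𝒩.N)))
    (g := monus (fst _ _) (snd _ _)) (fun a => by simp [monus_sc])
    (fun a n h => by
      simp only [comp_monus, comp_sc, lift_fst, lift_snd] at h ⊢
      rw [monus_sc, h, monus_sc]) m n
  simpa using this

@[simp]
lemma zr_monus {Γ : C} (n : Γ ⟶ 𝒩.N) : monus (𝒩.zr Γ) n = 𝒩.zr Γ := by
  have := comp_eq_of_induction (A := 𝟙_ C) (f := monus (𝒩.zr _) (snd _ _)) (g := 𝒩.zr _)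
    (fun a => by simp)
    (fun a n h => by
      simp only [comp_monus, lift_snd, comp_zr] at h ⊢
      rw [monus_sc, h, pr_zr]) (toUnit _) n
  simpa using this

@[simp]
lemma monus_self {Γ : C} (n : Γ ⟶ 𝒩.N) : monus n n = 𝒩.zr Γ := by
  have := comp_eq_of_induction (A := 𝟙_ C) (f := monus (snd _ _) (snd _ 𝒩.N)) (g := 𝒩.zr _)
    (fun a => by simp)
    (fun a n h => by
      simp only [comp_monus, lift_snd, comp_zr] at h ⊢
      rw [sc_monus_sc, h]) (toUnit _) n
  simpa using this

lemma sc_monus_self {Γ : C} (n : Γ ⟶ 𝒩.N) : monus (sc n) n = sc (𝒩.zr Γ) := by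
  have := comp_eq_of_induction (A := 𝟙_ C) (f := monus (sc (snd _ _)) (snd _ 𝒩.N))
    (g := sc (𝒩.zr _)) (fun a => by simp)
    (fun a n h => by
      simp only [comp_monus, comp_sc, lift_snd, comp_zr] at h ⊢
      rw [sc_monus_sc, h]) (toUnit _) n
  simpa using this

/-- Double induction: an equation which holds at `(0,n)` and `(m,0)`, and at `(sm,sn)` whenever it
holds at `(m,n)`, holds everywhere. -/
lemma hom_ext_double_induction (h2 : H2 𝒩) {B : C} {f g : 𝒩.N ⊗ 𝒩.N ⟶ B}
    (h₀ : ∀ {Γ : C} (n : Γ ⟶ 𝒩.N), lift (𝒩.zr Γ) n ≫ f = lift (𝒩.zr Γ) n ≫ g)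
    (h₀' : ∀ {Γ : C} (m : Γ ⟶ 𝒩.N), lift m (𝒩.zr Γ) ≫ f = lift m (𝒩.zr Γ) ≫ g)
    (h₁ : ∀ {Γ : C} (m n : Γ ⟶ 𝒩.N), lift m n ≫ f = lift m n ≫ g →
      lift (sc m) (sc n) ≫ f = lift (sc m) (sc n) ≫ g) : f = g := by
  have cases {Γ : C} (t m n : Γ ⟶ 𝒩.N)
      (H₀ : ∀ {Δ : C} (σ : Δ ⟶ Γ), σ ≫ t = 𝒩.zr Δ →
        lift (σ ≫ m) (σ ≫ n) ≫ f = lift (σ ≫ m) (σ ≫ n) ≫ g)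
      (H₁ : ∀ {Δ : C} (σ : Δ ⟶ Γ) (i : Δ ⟶ 𝒩.N), σ ≫ t = sc i →
        lift (σ ≫ m) (σ ≫ n) ≫ f = lift (σ ≫ m) (σ ≫ n) ≫ g) :
      lift m n ≫ f = lift m n ≫ g := by
    refine hom_ext_cases h2 t (fun σ hσ => ?_) (fun σ i hσ => ?_)
    · simpa only [comp_lift_assoc] using H₀ σ hσ
    · simpa only [comp_lift_assoc] using H₁ σ i hσ
  have stable {Δ Γ : C} (σ : Δ ⟶ Γ) {m n : Γ ⟶ 𝒩.N} (h : lift m n ≫ f = lift m n ≫ g) :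
      lift (σ ≫ m) (σ ≫ n) ≫ f = lift (σ ≫ m) (σ ≫ n) ≫ g := by
    simpa only [comp_lift_assoc] using congrArg (fun φ => σ ≫ φ) h
  -- Either a coordinate is zero, or both are successors and the predecessors are what the induction
  -- step needs.
  have of_pr {Γ : C} (m n : Γ ⟶ 𝒩.N) (h : lift (pr m) (pr n) ≫ f = lift (pr m) (pr n) ≫ g) :
      lift m n ≫ f = lift m n ≫ g := by
    refine cases m m n (fun σ hσ => ?_) (fun σ i hσ => ?_)
    · rw [hσ]
      exact h₀ _
    refine cases (σ ≫ n) _ _ (fun τ hτ => ?_) (fun τ j hτ => ?_)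
    · rw [hτ]
      exact h₀' _
    · have h' := stable τ (stable σ h)
      simp only [comp_pr, hσ, hτ, comp_sc, pr_sc] at h' ⊢
      exact h₁ _ _ h'
  let x : (𝒩.N ⊗ 𝒩.N) ⊗ 𝒩.N ⟶ 𝒩.N := fst _ _ ≫ fst _ _
  let y : (𝒩.N ⊗ 𝒩.N) ⊗ 𝒩.N ⟶ 𝒩.N := fst _ _ ≫ snd _ _
  -- Descend along the diagonal: with `k = x ∸ j`, induct on `j` for the equation at `(x ∸ k, y ∸
  -- k)`. At `j = 0` the first coordinate is `x ∸ x = 0`; at `j = x` we have `k = 0`, which gives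
  -- `(x,y)`.
  let k : (𝒩.N ⊗ 𝒩.N) ⊗ 𝒩.N ⟶ 𝒩.N := monus x (snd _ _)
  have key := comp_eq_of_induction
    (f := lift (monus x k) (monus y k) ≫ f) (g := lift (monus x k) (monus y k) ≫ g)
    (fun a => by simpa [x, y, k, comp_lift_assoc] using h₀ _)
    (fun a j h => by
      simp only [comp_lift_assoc, comp_monus, lift_snd, x, y, k, lift_fst_assoc] at h ⊢
      generalize a ≫ fst _ _ = p at h ⊢
      generalize a ≫ snd _ _ = q at h ⊢
      -- Raising `j` replaces `k` by `P(k)`. If `k = 0` the pair is unchanged; if `k = s(i)`, the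
      -- old pair is the coordinatewise predecessor of the new one, and `of_pr` applies.
      refine cases (monus p j) _ _ (fun σ hσ => ?_) (fun σ i hσ => ?_)
      all_goals
        have h' := stable σ h
        simp only [comp_monus, comp_pr, monus_sc] at hσ h' ⊢
        simp only [hσ, pr_zr, pr_sc, monus_sc] at h' ⊢
      · exact h'
      · exact of_pr _ _ h') (𝟙 _) (fst _ _)
  simpa [x, y, k, comp_lift_assoc] using key

/-- Double induction for a conditional equation `t(m,n) = 0 → x(m,n) = y(m,n)`. -/
lemma eq_of_double_induction (h2 : H2 𝒩) {B : C} {x y : 𝒩.N ⊗ 𝒩.N ⟶ B}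
    {t : 𝒩.N ⊗ 𝒩.N ⟶ 𝒩.N}
    (h₀ : ∀ {Γ : C} (n : Γ ⟶ 𝒩.N), lift (𝒩.zr Γ) n ≫ t = 𝒩.zr Γ →
      lift (𝒩.zr Γ) n ≫ x = lift (𝒩.zr Γ) n ≫ y)
    (h₀' : ∀ {Γ : C} (m : Γ ⟶ 𝒩.N), lift m (𝒩.zr Γ) ≫ t = 𝒩.zr Γ →
      lift m (𝒩.zr Γ) ≫ x = lift m (𝒩.zr Γ) ≫ y)
    (h₁ : ∀ {Γ : C} (m n : Γ ⟶ 𝒩.N),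
      (lift m n ≫ t = 𝒩.zr Γ → lift m n ≫ x = lift m n ≫ y) →
      lift (sc m) (sc n) ≫ t = 𝒩.zr Γ → lift (sc m) (sc n) ≫ x = lift (sc m) (sc n) ≫ y)
    {Γ : C} (m n : Γ ⟶ 𝒩.N) (h : lift m n ≫ t = 𝒩.zr Γ) : lift m n ≫ x = lift m n ≫ y := by
  -- The implication is not itself an equation of arrows; `ite(x,y,t) = y` is, and it specializes to
  -- `x = y` where `t = 0`.
  have key : lift (lift x y) t ≫ 𝒩.ite B = y := by
    refine hom_ext_double_induction h2 (fun n => ?_) (fun n => ?_) (fun m n H => ?_)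
    all_goals
      simp only [comp_lift_assoc, comp_lift] at *
      refine ite_eq_of_imp h2 (fun σ hσ => ?_)
      simp only [comp_lift_assoc, comp_zr, comp_sc] at *
    · exact h₀ _ hσ
    · exact h₀' _ hσ
    · refine h₁ _ _ (fun e => ?_) hσ
      have H' := congrArg (fun φ => σ ≫ φ) H
      simpa only [comp_lift_assoc, comp_lift, e, lift_zr_ite] using H'
  rw [← lift_zr_ite (lift m n ≫ x) (lift m n ≫ y), ← h, ← comp_lift, ← comp_lift_assoc, key]

/-- If `m < n` then `n ∸ m` is a successor. -/
lemma monus_eq_sc_of_lt (h2 : H2 𝒩) {Γ : C} {m n : Γ ⟶ 𝒩.N} (h : monus (sc m) n = 𝒩.zr Γ) :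
    monus n m = sc (monus n (sc m)) := by
  have := eq_of_double_induction h2 (x := monus (snd _ _) (fst _ _))
    (y := sc (monus (snd _ _) (sc (fst _ _)))) (t := monus (sc (fst _ _)) (snd _ _))
    (fun n hn => by
      simp only [comp_monus, comp_sc, comp_pr, lift_fst, lift_snd, monus_zr, monus_sc] at hn ⊢
      exact (𝒩.eq_pred_succ_of_lt _ _ hn).symm)
    (fun m hm => by
      simp only [comp_monus, comp_sc, lift_fst, lift_snd, monus_zr] at hm
      -- `m < 0` reads `s(m) = 0`.
      exact hom_ext_of_sc_eq_zr hm _ _)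
    (fun m n H => by simpa using H) m n (by simpa using h)
  simpa using this

lemma eq_sc_of_pr_eq_sc (h2 : H2 𝒩) {Γ : C} {m n : Γ ⟶ 𝒩.N} (h : pr m = sc n) :
    m = sc (sc n) := by
  refine hom_ext_cases h2 m (fun σ hσ => ?_) (fun σ i hσ => ?_)
  all_goals have h' := congrArg (fun φ => σ ≫ φ) h
  · change _ = 𝒩.zr _ at hσ
    simp only [comp_pr, comp_sc, hσ, pr_zr] at h'
    exact hom_ext_of_sc_eq_zr h'.symm _ _
  · change _ = sc i at hσ
    simp only [comp_pr, comp_sc, hσ, pr_sc] at h' ⊢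
    rw [h']

/-- The rule `s(n) ∸ k = s(n ∸ k)` fails for `k > n`, but `k = n ∸ m` never exceeds `n`. This is
what the inductive step of `monus_monus_of_lt` needs. -/
lemma sc_monus_monus (h2 : H2 𝒩) {Γ : C} (m n : Γ ⟶ 𝒩.N) :
    monus (sc n) (monus n m) = sc (monus n (monus n m)) := by
  have := comp_eq_of_induction
    (f := monus (sc (fst 𝒩.N 𝒩.N)) (monus (fst 𝒩.N 𝒩.N) (snd 𝒩.N 𝒩.N)))
    (g := sc (monus (fst 𝒩.N 𝒩.N) (monus (fst 𝒩.N 𝒩.N) (snd 𝒩.N 𝒩.N))))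
    (fun a => by simp [sc_monus_self])
    (fun n m h => by
      simp only [comp_monus, comp_sc, lift_fst, lift_snd] at h ⊢
      refine hom_ext_cases h2 (monus n m) (fun σ hσ => ?_) (fun σ i hσ => ?_)
      · change _ = 𝒩.zr _ at hσ
        simp only [comp_monus, comp_sc, monus_sc, comp_pr] at hσ ⊢
        simp [hσ]
      · change _ = sc i at hσ
        have h' := congrArg (fun φ => σ ≫ φ) h
        simp only [comp_monus, comp_sc, monus_sc, comp_pr] at hσ h' ⊢
        simp only [hσ, pr_sc, monus_sc] at h' ⊢
        -- With `n ∸ m = s(i)`, the induction hypothesis makes `P(s(n) ∸ i)` a successor, so `P` can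
        -- be undone on `s(n) ∸ i`.
        rw [eq_sc_of_pr_eq_sc h2 h', ← h', ← monus_sc, sc_monus_sc]) n m
  simpa using this

/-- If `m < n` then `n ∸ (n ∸ m) = m`. -/
lemma monus_monus_of_lt (h2 : H2 𝒩) {Γ : C} {m n : Γ ⟶ 𝒩.N} (h : monus (sc m) n = 𝒩.zr Γ) :
    monus n (monus n m) = m := by
  have := eq_of_double_induction h2 (x := monus (snd _ _) (monus (snd _ _) (fst _ _)))
    (y := fst _ _) (t := monus (sc (fst _ _)) (snd _ _))
    (fun n hn => by simp)
    (fun m hm => by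
      simp only [comp_monus, comp_sc, lift_fst, lift_snd, monus_zr] at hm
      exact hom_ext_of_sc_eq_zr hm _ _)
    (fun m n H e => by
      simp only [comp_monus, comp_sc, lift_fst, lift_snd, sc_monus_sc] at H e ⊢
      rw [sc_monus_monus h2, H e]) m n (by simpa using h)
  simpa using this

end Arithmetic
end NNO
/-! ### Operations on lists at generalized elements -/

namespace ListObject

open NNO

variable {X : C} {ℒ : ListObject X}

variable (ℒ) in
/-- The empty list as a generalized element. -/
noncomputable def nl (Γ : C) : Γ ⟶ ℒ.L := toUnit Γ ≫ ℒ.nil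

/-- Adding a leading element to a generalized element of `L`. -/
noncomputable def cs {Γ : C} (x : Γ ⟶ X) (l : Γ ⟶ ℒ.L) : Γ ⟶ ℒ.L := lift x l ≫ ℒ.cons

@[simp]
lemma comp_nl {Δ Γ : C} (σ : Δ ⟶ Γ) : σ ≫ ℒ.nl Γ = ℒ.nl Δ := by
  simp [nl]

@[simp]
lemma comp_cs {Δ Γ : C} (σ : Δ ⟶ Γ) (x : Γ ⟶ X) (l : Γ ⟶ ℒ.L) :
    σ ≫ cs x l = cs (σ ≫ x) (σ ≫ l) := by
  simp [cs, comp_lift_assoc]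

lemma lift_nl_recL {Γ A B : C} (g : A ⟶ B) (h : A ⊗ (X ⊗ (ℒ.L ⊗ B)) ⟶ B) (a : Γ ⟶ A) :
    lift a (ℒ.nl Γ) ≫ ℒ.recL g h = a ≫ g := by
  have e : lift (𝟙 A) (toUnit A ≫ ℒ.nil) ≫ ℒ.recL g h = g :=
    (ℒ.existsUnique_rec' g h).choose_spec.1.1
  conv_rhs => rw [← e, comp_lift_assoc, Category.comp_id, comp_toUnit_assoc]
  rfl

lemma lift_cs_recL {Γ A B : C} (g : A ⟶ B) (h : A ⊗ (X ⊗ (ℒ.L ⊗ B)) ⟶ B) (a : Γ ⟶ A)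
    (x : Γ ⟶ X) (l : Γ ⟶ ℒ.L) :
    lift a (cs x l) ≫ ℒ.recL g h = lift a (lift x (lift l (lift a l ≫ ℒ.recL g h))) ≫ h := by
  have e : (A ◁ ℒ.cons) ≫ ℒ.recL g h = _ := (ℒ.existsUnique_rec' g h).choose_spec.1.2
  have e' := congrArg (fun φ => lift a (lift x l) ≫ φ) e
  simpa [comp_lift_assoc, comp_lift, cs, recL] using e'

variable (𝒩 : NNO C)

@[simp]
lemma nl_len {Γ : C} : ℒ.nl Γ ≫ ℒ.len 𝒩 = 𝒩.zr Γ := by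
  simp [len, comp_lift_assoc, lift_nl_recL, zr]

@[simp]
lemma cs_len {Γ : C} (x : Γ ⟶ X) (l : Γ ⟶ ℒ.L) : cs x l ≫ ℒ.len 𝒩 = sc (l ≫ ℒ.len 𝒩) := by
  simp [len, comp_lift_assoc, lift_cs_recL, sc]

@[simp]
lemma nl_tr {Γ : C} : ℒ.nl Γ ≫ ℒ.tr = ℒ.nl Γ := by
  rw [tr, comp_lift_assoc, Category.comp_id, comp_toUnit, lift_nl_recL, nl]

@[simp]
lemma cs_tr {Γ : C} (x : Γ ⟶ X) (l : Γ ⟶ ℒ.L) : cs x l ≫ ℒ.tr = l := by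
  simp [tr, comp_lift_assoc, lift_cs_recL]

variable {𝒩}

lemma lift_zr_tail {Γ : C} (l : Γ ⟶ ℒ.L) : lift (𝒩.zr Γ) l ≫ ℒ.tail 𝒩 = l := by
  simp [tail, comp_lift_assoc, lift_zr_recN]

lemma lift_sc_tail {Γ : C} (n : Γ ⟶ 𝒩.N) (l : Γ ⟶ ℒ.L) :
    lift (sc n) l ≫ ℒ.tail 𝒩 = (lift n l ≫ ℒ.tail 𝒩) ≫ ℒ.tr := by
  simp [tail, comp_lift_assoc, lift_sc_recN]

lemma lift_cs_zerothDef {Γ : C} (d x : Γ ⟶ X) (l : Γ ⟶ ℒ.L) :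
    lift d (cs x l) ≫ ℒ.zerothDef = x := by
  simp [zerothDef, lift_cs_recL]

lemma lift_nthDef {Γ : C} (d : Γ ⟶ X) (n : Γ ⟶ 𝒩.N) (l : Γ ⟶ ℒ.L) :
    lift d (lift n l) ≫ ℒ.nthDef 𝒩 = lift d (lift n l ≫ ℒ.tail 𝒩) ≫ ℒ.zerothDef := by
  simp [nthDef]

/-! ### Lists of values of a total function -/

variable {A : C} (l : A ⟶ 𝒩.N) (G : A ⊗ 𝒩.N ⟶ X)

variable (ℒ) in
/-- The list `[G(a, l(a) ∸ n), …, G(a, l(a) ∸ 1)]` as a function of `(a,n)`. -/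
noncomputable def lastValues : A ⊗ 𝒩.N ⟶ ℒ.L :=
  𝒩.recN (ℒ.nl A)
    (cs (lift (fst _ _) (monus (fst _ _ ≫ l) (sc (snd _ _ ≫ fst _ _))) ≫ G) (snd _ _ ≫ snd _ _))

@[simp]
lemma lift_zr_lastValues {Γ : C} (a : Γ ⟶ A) :
    lift a (𝒩.zr Γ) ≫ ℒ.lastValues l G = ℒ.nl Γ := by
  simp [lastValues, lift_zr_recN]

@[simp]
lemma lift_sc_lastValues {Γ : C} (a : Γ ⟶ A) (n : Γ ⟶ 𝒩.N) :
    lift a (sc n) ≫ ℒ.lastValues l G =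
      cs (lift a (monus (a ≫ l) (sc n)) ≫ G) (lift a n ≫ ℒ.lastValues l G) := by
  simp [lastValues, lift_sc_recN, comp_lift_assoc]

variable [HasFiniteLimits C]

lemma lift_lastValues_len {Γ : C} (a : Γ ⟶ A) (n : Γ ⟶ 𝒩.N) :
    (lift a n ≫ ℒ.lastValues l G) ≫ ℒ.len 𝒩 = n := by
  have := comp_eq_of_induction (f := ℒ.lastValues l G ≫ ℒ.len 𝒩) (g := snd A 𝒩.N)
    (fun a => by rw [← Category.assoc]; simp)
    (fun a n h => by
      rw [← Category.assoc, lift_snd] at h ⊢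
      simp [h]) a n
  simpa using this

/-- No positivity of `n` is needed: the conventions `tr(∅) = ∅` and `P(0) = 0` match. -/
lemma lift_lastValues_tr {Γ : C} (a : Γ ⟶ A) (n : Γ ⟶ 𝒩.N) :
    (lift a n ≫ ℒ.lastValues l G) ≫ ℒ.tr = lift a (pr n) ≫ ℒ.lastValues l G := by
  have := comp_eq_of_induction (f := ℒ.lastValues l G ≫ ℒ.tr)
    (g := lift (fst A 𝒩.N) (pr (snd A 𝒩.N)) ≫ ℒ.lastValues l G)
    (fun a => by rw [← Category.assoc]; simp [comp_lift_assoc])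
    (fun a n h => by rw [← Category.assoc]; simp [comp_lift_assoc]) a n
  simpa [comp_lift_assoc] using this

lemma tail_lastValues {Γ : C} (a : Γ ⟶ A) (n m : Γ ⟶ 𝒩.N) :
    lift m (lift a n ≫ ℒ.lastValues l G) ≫ ℒ.tail 𝒩 = lift a (monus n m) ≫ ℒ.lastValues l G := by
  have := comp_eq_of_induction
    (f := lift (snd (A ⊗ 𝒩.N) 𝒩.N) (fst _ _ ≫ ℒ.lastValues l G) ≫ ℒ.tail 𝒩)
    (g := lift (fst _ _ ≫ fst _ _) (monus (fst (A ⊗ 𝒩.N) 𝒩.N ≫ snd _ _) (snd _ _)) ≫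
      ℒ.lastValues l G)
    (fun a => by simp [comp_lift_assoc, lift_zr_tail])
    (fun a m h => by
      simp only [comp_lift_assoc, lift_snd, lift_fst_assoc, comp_monus] at h ⊢
      rw [lift_sc_tail, h, lift_lastValues_tr, monus_sc]) (lift a n) m
  simpa [comp_lift_assoc] using this

/-- A total function `G` can be tabulated: there is a list of length `l(a)` with entry `G(a,m)` at
every position `m < l(a)`. -/
lemma exists_tabulate (h2 : H2 𝒩) : ∃ h : A ⟶ ℒ.L, h ≫ ℒ.len 𝒩 = l ∧
    ∀ {Γ : C} (a : Γ ⟶ A) (m : Γ ⟶ 𝒩.N) (d : Γ ⟶ X), 𝒩.ltTerm m (a ≫ l) = 𝒩.zr Γ →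
      lift d (lift m (a ≫ h)) ≫ ℒ.nthDef 𝒩 = lift a m ≫ G := by
  refine ⟨lift (𝟙 A) l ≫ ℒ.lastValues l G, lift_lastValues_len l G _ _, fun a m d hm => ?_⟩
  rw [ltTerm_eq_monus] at hm
  -- Since `m < l`, the tail at `l ∸ m` is nonempty and `d` plays no role; its leading entry has
  -- index `l ∸ (l ∸ m) = m`.
  rw [lift_nthDef, comp_lift_assoc, Category.comp_id, tail_lastValues, monus_eq_sc_of_lt h2 hm,
    lift_sc_lastValues, lift_cs_zerothDef, ← monus_eq_sc_of_lt h2 hm, monus_monus_of_lt h2 hm]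

end ListObject

/-! ### Partial functions on initial segments -/

section

open NNO

variable [HasFiniteLimits C] {𝒩 : NNO C} {ℒ : ∀ X : C, ListObject X} {X A : C} {lA : A ⟶ 𝒩.N}

/-- The element `(m,n)` of `E`, for `m < n`. -/
noncomputable def E.mk {Γ : C} (m n : Γ ⟶ 𝒩.N) (h : 𝒩.ltTerm m n = 𝒩.zr Γ) : Γ ⟶ E 𝒩 :=
  equalizer.lift (lift m n) (by
    rw [comp_ltTerm, lift_fst, lift_snd, h, comp_toUnit_assoc]
    rfl)

lemma E.mk_incl {Γ : C} (m n : Γ ⟶ 𝒩.N) (h : 𝒩.ltTerm m n = 𝒩.zr Γ) :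
    E.mk m n h ≫ E.incl 𝒩 = lift m n :=
  equalizer.lift_ι _ _

lemma E.mk_π₁ {Γ : C} (m n : Γ ⟶ 𝒩.N) (h : 𝒩.ltTerm m n = 𝒩.zr Γ) :
    E.mk m n h ≫ E.π₁ 𝒩 = m := by
  rw [E.π₁, ← Category.assoc, E.mk_incl, lift_fst]

lemma E.mk_π₂ {Γ : C} (m n : Γ ⟶ 𝒩.N) (h : 𝒩.ltTerm m n = 𝒩.zr Γ) :
    E.mk m n h ≫ E.π₂ 𝒩 = n := by
  rw [E.π₂, ← Category.assoc, E.mk_incl, lift_snd]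

lemma E.hom_ext {Γ : C} {p q : Γ ⟶ E 𝒩} (h₁ : p ≫ E.π₁ 𝒩 = q ≫ E.π₁ 𝒩)
    (h₂ : p ≫ E.π₂ 𝒩 = q ≫ E.π₂ 𝒩) : p = q := by
  have h : p ≫ E.incl 𝒩 = q ≫ E.incl 𝒩 :=
    CartesianMonoidalCategory.hom_ext _ _ (by simpa [E.π₁] using h₁) (by simpa [E.π₂] using h₂)
  exact equalizer.hom_ext h

/-- The element `(m,a)` of `E ×_N A`, for `m < lA(a)`. -/
noncomputable def EPull.mk {Γ : C} (m : Γ ⟶ 𝒩.N) (a : Γ ⟶ A)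
    (h : 𝒩.ltTerm m (a ≫ lA) = 𝒩.zr Γ) : Γ ⟶ EPull 𝒩 lA :=
  pullback.lift (E.mk m (a ≫ lA) h) a (E.mk_π₂ _ _ h)

lemma EPull.mk_snd {Γ : C} (m : Γ ⟶ 𝒩.N) (a : Γ ⟶ A) (h : 𝒩.ltTerm m (a ≫ lA) = 𝒩.zr Γ) :
    EPull.mk m a h ≫ pullback.snd (E.π₂ 𝒩) lA = a :=
  pullback.lift_snd _ _ _

lemma EPull.mk_fst {Γ : C} (m : Γ ⟶ 𝒩.N) (a : Γ ⟶ A) (h : 𝒩.ltTerm m (a ≫ lA) = 𝒩.zr Γ) :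
    EPull.mk m a h ≫ pullback.fst (E.π₂ 𝒩) lA ≫ E.π₁ 𝒩 = m := by
  rw [EPull.mk, pullback.lift_fst_assoc, E.mk_π₁]

/-- The second coordinate of the `E`-component is `lA(a)`, hence determined by `a`. -/
lemma EPull.hom_ext {Γ : C} {p q : Γ ⟶ EPull 𝒩 lA}
    (h₁ : p ≫ pullback.fst (E.π₂ 𝒩) lA ≫ E.π₁ 𝒩 = q ≫ pullback.fst (E.π₂ 𝒩) lA ≫ E.π₁ 𝒩)
    (h₂ : p ≫ pullback.snd (E.π₂ 𝒩) lA = q ≫ pullback.snd (E.π₂ 𝒩) lA) : p = q := by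
  have h := congrArg (fun φ => φ ≫ lA) h₂
  simp only [Category.assoc, ← pullback.condition] at h
  exact pullback.hom_ext (E.hom_ext (by simpa using h₁) (by simpa using h)) h₂

lemma EPull.lt {Γ : C} (p : Γ ⟶ EPull 𝒩 lA) :
    𝒩.ltTerm (p ≫ pullback.fst (E.π₂ 𝒩) lA ≫ E.π₁ 𝒩) ((p ≫ pullback.snd (E.π₂ 𝒩) lA) ≫ lA) =
      𝒩.zr Γ := by
  rw [Category.assoc, ← pullback.condition, ← Category.assoc, ← Category.assoc, ← comp_ltTerm,
    E.lt, comp_toUnit_assoc, zr]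

lemma EPull.map_fst {B : C} {lB : B ⟶ 𝒩.N} (h : A ⟶ B) (w : h ≫ lB = lA) :
    EPull.map 𝒩 h w ≫ pullback.fst (E.π₂ 𝒩) lB = pullback.fst (E.π₂ 𝒩) lA :=
  (pullback.lift_fst _ _ _).trans (Category.comp_id _)

lemma EPull.map_snd {B : C} {lB : B ⟶ 𝒩.N} (h : A ⟶ B) (w : h ≫ lB = lA) :
    EPull.map 𝒩 h w ≫ pullback.snd (E.π₂ 𝒩) lB = pullback.snd (E.π₂ 𝒩) lA ≫ h :=
  pullback.lift_snd _ _ _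

/-- A partial function `g` defined at `(m,a)` for `m < lA(a)` extends to a total function, given a
default value. -/
lemma EPull.exists_extension (h2 : H2 𝒩) (d : A ⟶ X) (g : EPull 𝒩 lA ⟶ X) :
    ∃ G : A ⊗ 𝒩.N ⟶ X, ∀ {Γ : C} (p : Γ ⟶ EPull 𝒩 lA),
      lift (p ≫ pullback.snd (E.π₂ 𝒩) lA) (p ≫ pullback.fst (E.π₂ 𝒩) lA ≫ E.π₁ 𝒩) ≫ G =
        p ≫ g := by
  let t : A ⊗ 𝒩.N ⟶ 𝒩.N := 𝒩.ltTerm (snd _ _) (fst _ _ ≫ lA)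
  let i := pullback.fst t 𝒩.zero
  have hi : 𝒩.ltTerm (i ≫ snd _ _) ((i ≫ fst _ _) ≫ lA) = 𝒩.zr _ := by
    rw [Category.assoc, ← comp_ltTerm, zr, ← toUnit_unique (pullback.snd t 𝒩.zero) (toUnit _)]
    exact pullback.condition
  -- The values of `G` outside `m < lA(a)` do not matter, so the second gluing equation is dropped.
  obtain ⟨G, hG, -⟩ := exists_glue h2 t (EPull.mk (i ≫ snd _ _) (i ≫ fst _ _) hi ≫ g)
    (pullback.fst t 𝒩.succ ≫ fst _ _ ≫ d)
  refine ⟨G, fun p => ?_⟩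
  let q := pullback.lift (f := t) (g := 𝒩.zero)
    (lift (p ≫ pullback.snd (E.π₂ 𝒩) lA) (p ≫ pullback.fst (E.π₂ 𝒩) lA ≫ E.π₁ 𝒩)) (toUnit _) (by
      rw [comp_ltTerm, lift_snd, lift_fst_assoc]
      exact EPull.lt p)
  have hq : q ≫ i =
      lift (p ≫ pullback.snd (E.π₂ 𝒩) lA) (p ≫ pullback.fst (E.π₂ 𝒩) lA ≫ E.π₁ 𝒩) :=
    pullback.lift_fst _ _ _
  rw [← hq, Category.assoc, hG, ← Category.assoc]
  congr 1
  refine EPull.hom_ext ?_ ?_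
  · rw [Category.assoc, EPull.mk_fst, ← Category.assoc, hq, lift_snd]
  · rw [Category.assoc, EPull.mk_snd, ← Category.assoc, hq, lift_fst]

/-- Tabulate a total extension of `g`. The fallback `x` is arbitrary and unrelated to `d`, so that
`def_X` can be substituted for it later. -/
lemma EPull.exists_nthDef_of_default (h2 : H2 𝒩) (d : A ⟶ X) (g : EPull 𝒩 lA ⟶ X) :
    ∃ h : A ⟶ (ℒ X).L, h ≫ (ℒ X).len 𝒩 = lA ∧
      ∀ {Γ : C} (p : Γ ⟶ EPull 𝒩 lA) (x : Γ ⟶ X),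
        lift x (lift (p ≫ pullback.fst (E.π₂ 𝒩) lA ≫ E.π₁ 𝒩)
          ((p ≫ pullback.snd (E.π₂ 𝒩) lA) ≫ h)) ≫ (ℒ X).nthDef 𝒩 = p ≫ g := by
  obtain ⟨G, hG⟩ := EPull.exists_extension h2 d g
  obtain ⟨h, hl, hh⟩ := ListObject.exists_tabulate (ℒ := ℒ X) lA G h2
  exact ⟨h, hl, fun p x => by rw [hh _ _ _ (EPull.lt p), hG]⟩

/-- A partial function defined at `(m,a)` for `m < lA(a)` can be tabulated. -/
lemma EPull.exists_nthDef (h2 : H2 𝒩) (g : EPull 𝒩 lA ⟶ X) :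
    ∃ h : A ⟶ (ℒ X).L, h ≫ (ℒ X).len 𝒩 = lA ∧
      ∀ {Γ : C} (p : Γ ⟶ EPull 𝒩 lA) (x : Γ ⟶ X),
        lift x (lift (p ≫ pullback.fst (E.π₂ 𝒩) lA ≫ E.π₁ 𝒩)
          ((p ≫ pullback.snd (E.π₂ 𝒩) lA) ≫ h)) ≫ (ℒ X).nthDef 𝒩 = p ≫ g := by
  let i := pullback.fst lA 𝒩.succ
  -- Over the successor part `0 < lA(a)`, so `g(0,a)` is a default value.
  let d : pullback lA 𝒩.succ ⟶ X := EPull.mk (lA := i ≫ lA) (𝒩.zr _) (𝟙 _) (by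
    rw [Category.id_comp, pullback.condition, ltTerm_eq_monus]
    exact (sc_monus_sc _ _).trans (zr_monus _)) ≫ EPull.map 𝒩 i rfl ≫ g
  obtain ⟨h₁, hl₁, hh₁⟩ :=
    EPull.exists_nthDef_of_default (ℒ := ℒ) h2 d (EPull.map 𝒩 i rfl ≫ g)
  obtain ⟨h, hn, hs⟩ := exists_glue h2 lA ((ℒ X).nl _) h₁
  have factor {B Γ : C} {k : B ⟶ 𝒩.N} (a : Γ ⟶ A) (b : Γ ⟶ B) (e : a ≫ lA = b ≫ k) :
      ∃ τ : Γ ⟶ pullback lA k, τ ≫ pullback.fst lA k = a :=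
    ⟨pullback.lift a b e, pullback.lift_fst _ _ _⟩
  refine ⟨h, ?_, fun p x => ?_⟩
  · refine hom_ext_cases h2 lA (fun σ hσ => ?_) (fun σ j hσ => ?_)
    · obtain ⟨τ, hτ⟩ := factor _ _ hσ
      rw [← Category.assoc, ← hτ, Category.assoc τ, hn, ListObject.comp_nl, ListObject.nl_len,
        hτ, hσ, zr]
    · obtain ⟨τ, hτ⟩ := factor _ _ hσ
      rw [← Category.assoc, ← hτ, Category.assoc τ, hs, Category.assoc, hl₁, Category.assoc]
  · refine hom_ext_cases h2 ((p ≫ pullback.snd (E.π₂ 𝒩) lA) ≫ lA) (fun σ hσ => ?_)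
      (fun σ j hσ => ?_)
    · have h := EPull.lt (σ ≫ p)
      simp only [Category.assoc] at h hσ
      rw [hσ] at h
      -- An index `m < 0` cannot occur, so over the empty lists there is nothing to check.
      exact hom_ext_of_sc_eq_zr ((monus_zr _).symm.trans h) _ _
    · rw [← Category.assoc] at hσ
      obtain ⟨τ, hτ⟩ := factor _ _ hσ
      -- The point `(m,a)`, regarded over the part of `A` where `lA` is a successor; there `h`
      -- restricts to `h₁`.
      let q : _ ⟶ EPull 𝒩 (i ≫ lA) :=
        EPull.mk (σ ≫ p ≫ pullback.fst (E.π₂ 𝒩) lA ≫ E.π₁ 𝒩) τ (by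
          rw [← Category.assoc τ, hτ]
          simpa using EPull.lt (σ ≫ p))
      have hq : q ≫ EPull.map 𝒩 i rfl = σ ≫ p := by
        refine EPull.hom_ext ?_ ?_
        · rw [Category.assoc, ← Category.assoc (EPull.map _ _ _), EPull.map_fst, EPull.mk_fst,
            Category.assoc]
        · rw [Category.assoc, EPull.map_snd, ← Category.assoc, EPull.mk_snd, hτ, Category.assoc]
      have key := hh₁ q (σ ≫ x)
      rw [EPull.mk_fst, EPull.mk_snd, ← Category.assoc q, hq, ← hs, ← Category.assoc τ, hτ] at key
      simpa [comp_lift_assoc, comp_lift] using key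

end

end ListPoly

theorem mainTheorem5 {C : Type u} [Category.{v} C] [CartesianMonoidalCategory C]
    [HasFiniteLimits C] (𝒩 : ListPoly.NNO C) (ℒ : ∀ X : C, ListPoly.ListObject X)
    (h1 : ListPoly.H1 𝒩 ℒ) (h2 : ListPoly.H2 𝒩)
    (X A : C) (lA : A ⟶ 𝒩.N) (g : ListPoly.EPull 𝒩 lA ⟶ X) :
    ∃ (h : A ⟶ (ℒ X).L) (w : h ≫ (ℒ X).len 𝒩 = lA),
      ListPoly.EPull.map 𝒩 h w ≫ ListPoly.nth h1 X = g := by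
  obtain ⟨h, w, hh⟩ := ListPoly.EPull.exists_nthDef (ℒ := ℒ) h2 g
  refine ⟨h, w, ?_⟩
  -- Take the generic point of `E ×_N A`, with fallback `def_X` evaluated at `(m, h(a))`.
  have key := hh (𝟙 _) (ListPoly.EPull.map 𝒩 h w ≫ ListPoly.defElt h1 X)
  rw [Category.id_comp, Category.id_comp, Category.id_comp] at key
  rw [← key, ListPoly.nth, comp_lift_assoc, comp_lift, ListPoly.EPull.map_snd,
    ← Category.assoc (ListPoly.EPull.map _ _ _), ListPoly.EPull.map_fst]
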